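/- Let $n\ge 3$ be an integer. For a finite simple graph $G$ of order $n$ with degree matrix $D(G)$ and adjacency matrix $A(G)$, let $\nu_1(G)\ge\cdots\ge\nu_n(G)$ be the eigenvalues, counted with multiplicity, of the signless Laplacian matrix $Q(G)=D(G)+A(G)$, and let $IE(G)=\sum_{i=1}^n\sqrt{\nu_i(G)}$ be the incidence energy of $G$. A unicyclic graph is a connected graph with as many edges as vertices; its girth is the length of its unique cycle. Let $S_3'$ be the graph of order $n$ obtained from a triangle by attaching $n-3$ pendent edges at one of its vertices. Then $S_3'$ is a unicyclic graph of order $n$ with odd girth, and every unicyclic graph $G$ of order $n$ with odd girth satisfies $IE(G)\ge IE(S_3')$, with equality if and only if $G$ is isomorphic to $S_3'$. -/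

import Mathlib

/-- A unicyclic graph: a connected graph with as many edges as vertices. -/
def SimpleGraph.IsUnicyclic {V : Type*} [Fintype V] (G : SimpleGraph V) : Prop :=
  G.Connected ∧ G.edgeSet.ncard = Fintype.card V

/-- The signless Laplacian matrix `Q(G) = D(G) + A(G)`. -/
def SimpleGraph.signlessLapMatrix {V : Type*} [Fintype V] [DecidableEq V]
    (G : SimpleGraph V) [DecidableRel G.Adj] : Matrix V V ℝ :=
  G.degMatrix ℝ + G.adjMatrix ℝ

theorem SimpleGraph.isHermitian_signlessLapMatrix {V : Type*} [Fintype V] [DecidableEq V]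
    (G : SimpleGraph V) [DecidableRel G.Adj] : G.signlessLapMatrix.IsHermitian := by
  rw [Matrix.IsHermitian, Matrix.conjTranspose_eq_transpose_of_trivial,
    SimpleGraph.signlessLapMatrix, Matrix.transpose_add, SimpleGraph.degMatrix,
    Matrix.diagonal_transpose, SimpleGraph.transpose_adjMatrix]

/-- The incidence energy: the sum of the square roots of the eigenvalues, counted with
multiplicity, of the (positive semidefinite) signless Laplacian matrix. -/
noncomputable def SimpleGraph.incidenceEnergy {V : Type*} [Fintype V] [DecidableEq V]
    (G : SimpleGraph V) [DecidableRel G.Adj] : ℝ :=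
  ∑ i : V, Real.sqrt (G.isHermitian_signlessLapMatrix.eigenvalues i)

/-- The triangle on `Fin 3` with `k` pendent edges, whose pendent ends form `Fin k`, attached
at the vertex `2` of the triangle. -/
def trianglePendant (k : ℕ) : SimpleGraph (Fin 3 ⊕ Fin k) where
  Adj x y := match x, y with
    | .inl a, .inl b => a ≠ b
    | .inl a, .inr _ => a = 2
    | .inr _, .inl b => b = 2
    | .inr _, .inr _ => False
  symm := ⟨by
    rintro (a | a) (b | b) h
    · exact Ne.symm h
    · exact h
    · exact h
    · exact h⟩
  loopless := ⟨by
    rintro (a | a) h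
    · exact h rfl
    · exact h⟩

instance trianglePendant.decidableAdj (k : ℕ) : DecidableRel (trianglePendant k).Adj
  | .inl a, .inl b => inferInstanceAs (Decidable (a ≠ b))
  | .inl a, .inr _ => inferInstanceAs (Decidable (a = 2))
  | .inr _, .inl b => inferInstanceAs (Decidable (b = 2))
  | .inr _, .inr _ => inferInstanceAs (Decidable False)

/-! For `ν ≥ 0` one has `π √ν = ∫₀^∞ log (1 + ν s²) / s² ds`, so graphs can be compared through the
determinants `det (1 + t Q)`, `t > 0`: a pointwise inequality between them is inherited by the
incidence energies, and equality of the energies then forces equality of the determinants.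

Since `Q` is the sum of the rank-one matrices attached to the edges, `det (1 + t Q)` increases
strictly when an edge is added. A connected non-bipartite graph is therefore bounded below by any
spanning subgraph consisting of one of its odd cycles and edges attached one at a time to a new
vertex. Attaching such an edge at `a` changes the determinant by a recurrence which involves the
principal cofactor at `a`. The determinant and its cofactors at single vertices are bounded below
simultaneously, in terms of the number of vertices only, by the values for the triangle with
pendent edges, the cofactor being the one at the centre. An odd cycle satisfies these bounds because
`1 + t Q = (α + β P) (α + β P)ᵀ` with `P` the rotation, `α - β = 1` and `α β = t`. Equality forces
a vertex adjacent to all others; as the graph is not bipartite, it contains a spanning triangle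
with pendent edges, and strict monotonicity leaves no further edge. -/

open Filter Finset Matrix SimpleGraph Topology

section RootedDet

variable {V : Type*} [DecidableEq V]

/-- The column of the unoriented incidence matrix belonging to the edge `e`, with the entries at
the vertices of `R` replaced by `0`. -/
def rootedIncVec (R : Finset V) (e : Sym2 V) (v : V) : ℝ :=
  if v ∈ e ∧ v ∉ R then 1 else 0

/-- The signless Laplacian of the graph with edge set `E`, with the rows and columns of the root
vertices `R` replaced by `0`. -/
def rootedSignlessLap (R : Finset V) (E : Finset (Sym2 V)) : Matrix V V ℝ :=
  ∑ e ∈ E, vecMulVec (rootedIncVec R e) (rootedIncVec R e)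

/-- The determinant of `1 + t Q`, where `Q` is the signless Laplacian of the graph with edge set
`E`, after deletion of the rows and columns of the root vertices `R`. -/
def rootedDet [Fintype V] (t : ℝ) (R : Finset V) (E : Finset (Sym2 V)) : ℝ :=
  (1 + t • rootedSignlessLap R E).det

variable {t : ℝ} {R : Finset V} {E E' : Finset (Sym2 V)} {e : Sym2 V} {a v : V}

theorem rootedIncVec_mk (hav : a ≠ v) (R : Finset V) :
    rootedIncVec R s(v, a) =
      (if v ∈ R then 0 else Pi.single v 1) + (if a ∈ R then 0 else Pi.single a 1) := by
  ext x
  simp only [rootedIncVec, Sym2.mem_iff, Pi.add_apply]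
  by_cases hv : x = v
  · subst hv
    by_cases hR : x ∈ R <;> by_cases haR : a ∈ R <;> simp [hR, haR, hav.symm]
  · by_cases ha : x = a
    · subst ha
      by_cases hR : x ∈ R <;> by_cases hvR : v ∈ R <;> simp [hR, hvR, hav]
    · by_cases hvR : v ∈ R <;> by_cases haR : a ∈ R <;> simp [*]

theorem rootedSignlessLap_apply (i j : V) :
    rootedSignlessLap R E i j = ∑ e ∈ E, rootedIncVec R e i * rootedIncVec R e j := by
  simp only [rootedSignlessLap, Matrix.sum_apply, vecMulVec_apply]

theorem rootedSignlessLap_apply_of_isolated (hv : ∀ e ∈ E, v ∉ e) (j : V) :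
    rootedSignlessLap R E v j = 0 := by
  rw [rootedSignlessLap_apply]
  exact sum_eq_zero fun e he => by simp [rootedIncVec, hv e he]

theorem posSemidef_rootedSignlessLap [Finite V] : (rootedSignlessLap R E).PosSemidef :=
  posSemidef_sum _ fun e _ => by simpa using posSemidef_vecMulVec_self_star (rootedIncVec R e)

theorem posDef_one_add_smul_rootedSignlessLap [Finite V] (ht : 0 ≤ t) (R : Finset V)
    (E : Finset (Sym2 V)) : (1 + t • rootedSignlessLap R E).PosDef :=
  PosDef.one.add_posSemidef (posSemidef_rootedSignlessLap.smul ht)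

variable [Fintype V]

theorem signlessLapMatrix_eq_rootedSignlessLap (G : SimpleGraph V) [DecidableRel G.Adj] :
    G.signlessLapMatrix = rootedSignlessLap ∅ G.edgeFinset := by
  have hinc : G.signlessLapMatrix = G.incMatrix ℝ * (G.incMatrix ℝ)ᵀ := by
    ext i j
    rw [incMatrix_mul_transpose]
    by_cases hij : i = j
    · subst hij
      simp [signlessLapMatrix, degMatrix]
    · simp [signlessLapMatrix, degMatrix, hij, adjMatrix_apply]
  ext i j
  rw [hinc, rootedSignlessLap_apply, mul_apply, ← sum_subset (subset_univ G.edgeFinset)]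
  · refine sum_congr rfl fun e he => ?_
    simp [incMatrix_apply', rootedIncVec, incidenceSet, mem_edgeFinset.1 he]
  · intro e _ he
    simp [incMatrix_apply', incidenceSet, mem_edgeFinset.not.1 he]

theorem det_one_add_smul_signlessLapMatrix (G : SimpleGraph V) [DecidableRel G.Adj] (t : ℝ) :
    (1 + t • G.signlessLapMatrix).det = rootedDet t ∅ G.edgeFinset := by
  rw [rootedDet, signlessLapMatrix_eq_rootedSignlessLap]

theorem rootedDet_pos (ht : 0 ≤ t) (R : Finset V) (E : Finset (Sym2 V)) : 0 < rootedDet t R E :=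
  (posDef_one_add_smul_rootedSignlessLap ht R E).det_pos

theorem adjugate_eq_det_smul_inv {M : Matrix V V ℝ} (hM : M.PosDef) :
    M.adjugate = M.det • M⁻¹ := by
  rw [Matrix.inv_def, Ring.inverse_eq_inv', smul_smul, mul_inv_cancel₀ hM.det_pos.ne', one_smul]

theorem posDef_adjugate {M : Matrix V V ℝ} (hM : M.PosDef) : M.adjugate.PosDef := by
  rw [adjugate_eq_det_smul_inv hM]
  exact hM.inv.smul hM.det_pos

theorem det_add_smul_vecMulVec {M : Matrix V V ℝ} (hM : M.PosDef) (t : ℝ) (u : V → ℝ) :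
    (M + t • vecMulVec u u).det = M.det + t * (u ⬝ᵥ M.adjugate *ᵥ u) := by
  have hdet : (1 + replicateRow Unit u * M⁻¹ * (t • replicateCol Unit u)).det =
      1 + t * (u ⬝ᵥ M⁻¹ *ᵥ u) := by
    rw [det_unique, Matrix.mul_smul, Matrix.mul_assoc, ← replicateCol_mulVec, Matrix.add_apply,
      Matrix.smul_apply, replicateRow_mul_replicateCol_apply, one_apply_eq, smul_eq_mul]
  rw [vecMulVec_eq Unit, ← smul_mul, det_add_mul _ _ hM.det_pos.ne'.isUnit, hdet,
    adjugate_eq_det_smul_inv hM, smul_mulVec, dotProduct_smul, smul_eq_mul]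
  ring

theorem rootedDet_insert (he : e ∉ E) (ht : 0 ≤ t) :
    rootedDet t R (insert e E) = rootedDet t R E +
      t * (rootedIncVec R e ⬝ᵥ (1 + t • rootedSignlessLap R E).adjugate *ᵥ rootedIncVec R e) := by
  rw [rootedDet, rootedSignlessLap, sum_insert he, smul_add, add_comm (t • vecMulVec _ _),
    ← add_assoc]
  exact det_add_smul_vecMulVec (posDef_one_add_smul_rootedSignlessLap ht R E) t _

theorem rootedDet_le_insert (ht : 0 ≤ t) : rootedDet t R E ≤ rootedDet t R (insert e E) := by
  by_cases he : e ∈ E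
  · rw [insert_eq_of_mem he]
  · rw [rootedDet_insert he ht, le_add_iff_nonneg_right]
    have hadj := (posDef_adjugate (posDef_one_add_smul_rootedSignlessLap ht R E)).posSemidef
    exact mul_nonneg ht (by simpa using hadj.dotProduct_mulVec_nonneg (rootedIncVec R e))

theorem rootedDet_lt_insert (ht : 0 < t) (he : e ∉ E) (hv : v ∈ e) (hvR : v ∉ R) :
    rootedDet t R E < rootedDet t R (insert e E) := by
  rw [rootedDet_insert he ht.le, lt_add_iff_pos_right]
  have hadj := posDef_adjugate (posDef_one_add_smul_rootedSignlessLap ht.le R E)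
  have hne : rootedIncVec R e ≠ 0 := fun h => by
    simpa [rootedIncVec, hv, hvR] using congrFun h v
  exact mul_pos ht (by simpa using hadj.dotProduct_mulVec_pos hne)

theorem rootedDet_mono (ht : 0 ≤ t) (R : Finset V) : Monotone (rootedDet t R) :=
  monotone_iff_forall_le_insert.2 fun _ _ _ => rootedDet_le_insert ht

theorem rootedDet_empty_strictMono (ht : 0 < t) : StrictMono (rootedDet t (∅ : Finset V)) :=
  strictMono_iff_forall_lt_insert.2 fun _ e he =>
    rootedDet_lt_insert ht he e.out_fst_mem (notMem_empty _)

theorem adjugate_apply_self_eq_rootedDet (a : V) :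
    (1 + t • rootedSignlessLap R E).adjugate a a = rootedDet t (insert a R) E := by
  set L := rootedSignlessLap R E
  have hrow : ∀ i j, rootedSignlessLap (insert a R) E i j =
      if i = a ∨ j = a then 0 else L i j := fun i j => by
    simp only [L, rootedSignlessLap_apply, rootedIncVec, mem_insert]
    split_ifs with hij
    · rcases hij with rfl | rfl <;> simp
    · push Not at hij
      simp only [hij.1, hij.2, false_or]
  rw [adjugate_apply]
  refine det_eq_of_forall_row_eq_smul_add_const (fun i => if i = a then 0 else t * L i a) a
    (if_pos rfl) fun i j => ?_
  by_cases hi : i = a <;> by_cases hj : j = a <;>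
    simp [hrow, hi, hj, one_apply, eq_comm (a := a)]

section Isolated

variable (hv : ∀ e ∈ E, v ∉ e)

include hv

theorem rootedDet_insert_root_of_isolated : rootedDet t (insert v R) E = rootedDet t R E := by
  have hvec : ∀ e ∈ E, rootedIncVec (insert v R) e = rootedIncVec R e := fun e he => by
    ext x
    have : x ∈ e → x ≠ v := by rintro hx rfl; exact hv e he hx
    grind [rootedIncVec]
  rw [rootedDet, rootedDet, rootedSignlessLap, sum_congr rfl fun e he => by rw [hvec e he],
    rootedSignlessLap]

theorem adjugate_apply_of_isolated (ha : a ≠ v) :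
    (1 + t • rootedSignlessLap R E).adjugate v a = 0 := by
  rw [adjugate_apply]
  refine det_zero_of_row_eq ha (funext fun j => ?_)
  simp [updateRow_ne ha.symm, rootedSignlessLap_apply_of_isolated hv, one_apply, Pi.single_apply,
    eq_comm]

theorem adjugate_apply_self_of_isolated :
    (1 + t • rootedSignlessLap R E).adjugate v v = rootedDet t R E := by
  rw [adjugate_apply_self_eq_rootedDet, rootedDet_insert_root_of_isolated hv]

theorem rootedDet_insert_pendant (ht : 0 ≤ t) (ha : a ≠ v) (hvR : v ∉ R) (haR : a ∉ R) :
    rootedDet t R (insert s(v, a) E) =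
      (1 + t) * rootedDet t R E + t * rootedDet t (insert a R) E := by
  have hsymm : (1 + t • rootedSignlessLap R E).adjugate a v = 0 := by
    rw [← adjugate_apply_of_isolated hv ha]
    exact (posDef_adjugate (posDef_one_add_smul_rootedSignlessLap ht R E)).isHermitian.apply v a
  rw [rootedDet_insert (fun h => hv _ h (Sym2.mem_mk_left v a)) ht, rootedIncVec_mk ha,
    if_neg hvR, if_neg haR]
  simp only [mulVec_add, mulVec_single_one, dotProduct_add, add_dotProduct, single_dotProduct,
    col_apply, one_mul, adjugate_apply_of_isolated hv ha, hsymm, adjugate_apply_self_of_isolated hv,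
    adjugate_apply_self_eq_rootedDet]
  ring

theorem rootedDet_insert_pendant_of_mem (ht : 0 ≤ t) (ha : a ≠ v) (hvR : v ∉ R) (haR : a ∈ R) :
    rootedDet t R (insert s(v, a) E) = (1 + t) * rootedDet t R E := by
  rw [rootedDet_insert (fun h => hv _ h (Sym2.mem_mk_left v a)) ht, rootedIncVec_mk ha,
    if_neg hvR, if_pos haR, add_zero, mulVec_single_one, single_dotProduct, col_apply,
    adjugate_apply_self_of_isolated hv]
  ring

theorem rootedDet_insert_rooted_pendant (ht : 0 ≤ t) (ha : a ≠ v) (haR : a ∉ R) :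
    rootedDet t (insert v R) (insert s(v, a) E) =
      rootedDet t R E + t * rootedDet t (insert a R) E := by
  rw [rootedDet_insert (fun h => hv _ h (Sym2.mem_mk_left v a)) ht, rootedIncVec_mk ha,
    if_pos (mem_insert_self v R), if_neg (by simp [ha, haR]), zero_add, mulVec_single_one,
    single_dotProduct, col_apply, adjugate_apply_self_eq_rootedDet, insert_comm,
    rootedDet_insert_root_of_isolated hv, rootedDet_insert_root_of_isolated hv, one_mul]

theorem add_le_rootedDet_of_pendant (ht : 0 ≤ t) (ha : a ≠ v) (hvR : v ∉ R) (haR : a ∉ R)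
    (hE' : insert s(v, a) E ⊆ E') :
    (1 + t) * rootedDet t R E + t * rootedDet t (insert a R) E ≤ rootedDet t R E' :=
  rootedDet_insert_pendant hv ht ha hvR haR ▸ rootedDet_mono ht R hE'

theorem mul_le_rootedDet_of_pendant_of_mem (ht : 0 ≤ t) (ha : a ≠ v) (hvR : v ∉ R) (haR : a ∈ R)
    (hE' : insert s(v, a) E ⊆ E') : (1 + t) * rootedDet t R E ≤ rootedDet t R E' :=
  rootedDet_insert_pendant_of_mem hv ht ha hvR haR ▸ rootedDet_mono ht R hE'

theorem add_le_rootedDet_of_rooted_pendant (ht : 0 ≤ t) (ha : a ≠ v) (haR : a ∉ R)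
    (hE' : insert s(v, a) E ⊆ E') :
    rootedDet t R E + t * rootedDet t (insert a R) E ≤ rootedDet t (insert v R) E' :=
  rootedDet_insert_rooted_pendant hv ht ha haR ▸ rootedDet_mono ht _ hE'

end Isolated

variable {W : Type*} [DecidableEq W]

theorem rootedIncVec_map (f : V ↪ W) (R : Finset V) (e : Sym2 V) :
    rootedIncVec (R.map f) (f.sym2Map e) =
      (1 : Matrix W W ℝ).submatrix id f *ᵥ rootedIncVec R e := by
  ext w
  simp only [mulVec, dotProduct, submatrix_apply, one_apply, rootedIncVec, id, ite_mul, one_mul,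
    zero_mul]
  by_cases hw : ∃ x, f x = w
  · obtain ⟨x, rfl⟩ := hw
    simp only [f.injective.eq_iff, sum_ite_eq]
    simp
  · push Not at hw
    simp only [fun x => (hw x).symm, if_false, sum_const_zero, ite_eq_right_iff]
    simp [hw]

theorem rootedDet_map [Fintype W] (f : V ↪ W) (t : ℝ) (R : Finset V)
    (E : Finset (Sym2 V)) : rootedDet t (R.map f) (E.map f.sym2Map) = rootedDet t R E := by
  set P := (1 : Matrix W W ℝ).submatrix id f
  have hP : Pᵀ * P = 1 := by
    ext i j
    simp [P, mul_apply, one_apply]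
  have hlap : rootedSignlessLap (R.map f) (E.map f.sym2Map) = P * (rootedSignlessLap R E * Pᵀ) := by
    simp only [rootedSignlessLap, sum_map, Matrix.mul_sum, Matrix.sum_mul]
    refine sum_congr rfl fun e _ => ?_
    rw [rootedIncVec_map, vecMulVec_mul, mul_vecMulVec, vecMul_transpose]
  rw [rootedDet, rootedDet, hlap, ← Matrix.mul_smul, det_one_add_mul_comm, smul_mul,
    Matrix.mul_assoc, hP, Matrix.mul_one]

theorem rootedDet_edgeFinset_iso [Fintype W] {G : SimpleGraph V} [DecidableRel G.Adj]
    {H : SimpleGraph W} [DecidableRel H.Adj] (f : G ≃g H) (t : ℝ) (R : Finset V) :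
    rootedDet t (R.map f.toEquiv.toEmbedding) H.edgeFinset = rootedDet t R G.edgeFinset := by
  rw [← rootedDet_map f.toEquiv.toEmbedding]
  congr 1
  ext e
  obtain ⟨e, rfl⟩ : ∃ e', Sym2.map f e' = e := ⟨e.map f.symm, by simp [Sym2.map_map]⟩
  rw [mem_edgeFinset, f.map_mem_edgeSet_iff, ← mem_edgeFinset]
  exact (mem_map' f.toEquiv.toEmbedding.sym2Map).symm

end RootedDet

section Cycle

variable {α β t : ℝ} {n : ℕ}

/-- The permutation matrix of the rotation `i ↦ i + 1` of `Fin (n + 1)`. -/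
def cyclicShift (n : ℕ) : Matrix (Fin (n + 1)) (Fin (n + 1)) ℝ :=
  (Equiv.addRight 1).permMatrix ℝ

theorem cyclicShift_apply (i j : Fin (n + 1)) :
    cyclicShift n i j = if j = i + 1 then 1 else 0 := by
  simp [cyclicShift, Equiv.Perm.permMatrix, PEquiv.toMatrix_apply, eq_comm]

theorem cyclicShift_mul_transpose : cyclicShift n * (cyclicShift n)ᵀ = 1 := by
  rw [cyclicShift, transpose_permMatrix, ← permMatrix_mul, inv_mul_cancel, permMatrix_one]

theorem det_smul_one_add_smul_cyclicShift (α β : ℝ) (n : ℕ) :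
    (α • 1 + β • cyclicShift (n + 1)).det = α ^ (n + 2) + (-1) ^ (n + 1) * β ^ (n + 2) := by
  set A := α • (1 : Matrix (Fin (n + 2)) (Fin (n + 2)) ℝ) + β • cyclicShift (n + 1) with hA
  have hApp : ∀ i j, A i j = (if i = j then α else 0) + if j = i + 1 then β else 0 := fun i j => by
    simp [hA, one_apply, cyclicShift_apply]
  have hfirst : (A.submatrix (Fin.succAbove 0) Fin.succ).det = α ^ (n + 1) := by
    rw [det_of_isUpperTriangular]
    · simp [hApp]
    · intro i j hij
      change j < i at hij
      simp only [Matrix.submatrix_apply, hApp, Fin.ext_iff, Fin.val_add_one, Fin.zero_succAbove,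
        Fin.val_succ, Fin.val_last]
      grind
  have hlast : (A.submatrix (Fin.succAbove (Fin.last _)) Fin.succ).det = β ^ (n + 1) := by
    rw [det_of_isLowerTriangular]
    · simp [hApp, Fin.ext_iff]
    · intro i j hij
      change i < j at hij
      simp only [Matrix.submatrix_apply, hApp, Fin.ext_iff, Fin.val_add_one, Fin.succAbove_last,
        Fin.val_succ, Fin.val_last, Fin.val_castSucc]
      grind
  have hcol : ∀ i : Fin n, A i.castSucc.succ 0 = 0 := fun i => by
    simp only [hApp, Fin.ext_iff, Fin.val_add_one, Fin.val_succ, Fin.val_last, Fin.val_castSucc,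
      Fin.val_zero]
    grind
  have hA_zero : A 0 0 = α := by simp [hApp]
  have hA_last : A (Fin.last _) 0 = β := by simp [hApp]
  rw [det_succ_column_zero, Fin.sum_univ_succ, Fin.sum_univ_castSucc, hfirst, Fin.succ_last, hlast,
    hA_zero, hA_last, sum_eq_zero fun i _ => by rw [hcol, mul_zero, zero_mul], Fin.val_zero,
    Fin.val_last, Nat.succ_eq_add_one]
  ring

theorem det_smul_one_add_smul_cyclicShift_of_even (α β : ℝ) (hn : Even n) :
    (α • 1 + β • cyclicShift (n + 2)).det = α ^ (n + 3) + β ^ (n + 3) := by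
  have heven : Even (n + 1 + 1) := hn.add even_two
  rw [det_smul_one_add_smul_cyclicShift, heven.neg_one_pow, one_mul]

theorem signlessLapMatrix_cycleGraph :
    (cycleGraph (n + 3)).signlessLapMatrix =
      2 • 1 + (cyclicShift (n + 2) + (cyclicShift (n + 2))ᵀ) := by
  ext i j
  have hdisj : ¬ (j = i + 1 ∧ i = j + 1) := fun h => by
    simp only [Fin.ext_iff, Fin.val_add_one, Fin.val_last] at h
    grind
  simp only [signlessLapMatrix, Matrix.add_apply, degMatrix, diagonal_apply, adjMatrix_apply,
    cycleGraph_degree_three_le, cycleGraph_adj, sub_eq_iff_eq_add', Matrix.smul_apply, one_apply,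
    transpose_apply, cyclicShift_apply]
  grind

theorem one_add_smul_signlessLapMatrix_cycleGraph (hsub : α - β = 1) (hmul : α * β = t) :
    1 + t • (cycleGraph (n + 3)).signlessLapMatrix =
      (α • 1 + β • cyclicShift (n + 2)) * (α • 1 + β • cyclicShift (n + 2))ᵀ := by
  have hsq : α * α + β * β = 1 + 2 * t := by linear_combination (α - β + 1) * hsub + 2 * hmul
  rw [signlessLapMatrix_cycleGraph]
  simp only [transpose_add, transpose_smul, transpose_one, add_mul, mul_add, smul_mul_smul_comm,
    mul_one, one_mul, cyclicShift_mul_transpose, mul_comm β α, hmul, smul_add]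
  match_scalars
  · linear_combination -hsq
  all_goals ring

theorem rootedDet_cycleGraph (hsub : α - β = 1) (hmul : α * β = t) (hn : Even n) :
    rootedDet t ∅ (cycleGraph (n + 3)).edgeFinset = (α ^ (n + 3) + β ^ (n + 3)) ^ 2 := by
  rw [← det_one_add_smul_signlessLapMatrix, one_add_smul_signlessLapMatrix_cycleGraph hsub hmul,
    det_mul, det_transpose, det_smul_one_add_smul_cyclicShift_of_even α β hn, sq]

theorem adjugate_smul_one_add_smul_cyclicShift_last (hα : 0 < α) (hβ : 0 ≤ β) (hn : Even n)
    (i : Fin (n + 3)) :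
    (α • 1 + β • cyclicShift (n + 2)).adjugate i (Fin.last _) =
      α ^ (i : ℕ) * (-β) ^ (n + 2 - i) := by
  set A := α • (1 : Matrix (Fin (n + 3)) (Fin (n + 3)) ℝ) + β • cyclicShift (n + 2) with hA
  have hdet := det_smul_one_add_smul_cyclicShift_of_even α β hn
  set y : Fin (n + 3) → ℝ := fun i => α ^ (i : ℕ) * (-β) ^ (n + 2 - i)
  have hmulVec : ∀ i, (A *ᵥ y) i = α * y i + β * y (i + 1) := fun i => by
    simp [hA, add_mulVec, smul_mulVec, cyclicShift, permMatrix_mulVec]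
  have hAy : A *ᵥ y = A.det • Pi.single (Fin.last _) 1 := by
    ext i
    rw [hmulVec]
    refine i.lastCases ?_ fun j => ?_
    · rw [Fin.last_add_one, hdet]
      simp only [y, Fin.val_last, Fin.val_zero, Nat.sub_self, Nat.sub_zero, pow_zero,
        (hn.add even_two).neg_pow, Pi.smul_apply, Pi.single_eq_same, smul_eq_mul]
      ring
    · obtain ⟨m, hm⟩ : ∃ m, n + 2 - (j : ℕ) = m + 1 := ⟨n + 1 - j, by lia⟩
      rw [Fin.coeSucc_eq_succ, Pi.smul_apply, Pi.single_eq_of_ne (Fin.castSucc_ne_last j),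
        smul_zero]
      simp only [y, Fin.val_castSucc, Fin.val_succ, hm, show n + 2 - (j + 1) = m by lia]
      ring
  have hy : A.det • y = A.det • A.adjugate.col (Fin.last _) := by
    rw [← mulVec_single_one, ← mulVec_smul, ← hAy, mulVec_mulVec, adjugate_mul, smul_mulVec,
      one_mulVec]
  have hpos : 0 < A.det := hdet ▸ (by positivity)
  exact (congrFun (smul_right_injective _ hpos.ne' hy) i).symm

theorem rootedDet_singleton_last_cycleGraph (hsub : α - β = 1) (hmul : α * β = t) (hα : 0 < α)
    (hβ : 0 ≤ β) (hn : Even n) :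
    rootedDet t {Fin.last _} (cycleGraph (n + 3)).edgeFinset =
      ∑ i ∈ range (n + 3), (α ^ 2) ^ i * (β ^ 2) ^ (n + 2 - i) := by
  rw [← insert_empty_eq, ← adjugate_apply_self_eq_rootedDet,
    ← signlessLapMatrix_eq_rootedSignlessLap, one_add_smul_signlessLapMatrix_cycleGraph hsub hmul,
    adjugate_mul_distrib, ← adjugate_transpose, mul_apply,
    ← Fin.sum_univ_eq_sum_range (fun i => (α ^ 2) ^ i * (β ^ 2) ^ (n + 2 - i))]
  refine sum_congr rfl fun i _ => ?_
  rw [transpose_apply, adjugate_smul_one_add_smul_cyclicShift_last hα hβ hn, mul_mul_mul_comm,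
    ← mul_pow, ← mul_pow, neg_mul_neg, sq, sq]

theorem rootedDet_singleton_cycleGraph (a : Fin (n + 3)) :
    rootedDet t {a} (cycleGraph (n + 3)).edgeFinset =
      rootedDet t {Fin.last _} (cycleGraph (n + 3)).edgeFinset := by
  let rotation : cycleGraph (n + 3) ≃g cycleGraph (n + 3) :=
    { toEquiv := Equiv.addRight (Fin.last _ - a)
      map_rel_iff' := by simp [cycleGraph_adj] }
  rw [← rootedDet_edgeFinset_iso rotation, map_singleton]
  simp [rotation]

end Cycle

section Extremal

/-- The value of `rootedDet t {z}` for the graph consisting of a triangle with `k` pendent edges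
attached at its vertex `z`. -/
def extremalRootedDet (t : ℝ) (k : ℕ) : ℝ :=
  (1 + t) ^ (k + 1) * (1 + 3 * t)

/-- The value of `rootedDet t ∅` for the graph consisting of a triangle with `k` pendent edges
attached at one of its vertices. -/
def extremalDet (t : ℝ) (k : ℕ) : ℝ :=
  (1 + t) ^ (k + 2) * (1 + 4 * t) + k * t * (1 + t) ^ k * (1 + 3 * t)

theorem extremalRootedDet_succ (t : ℝ) (k : ℕ) :
    extremalRootedDet t (k + 1) = (1 + t) * extremalRootedDet t k := by
  simp only [extremalRootedDet]
  ring

theorem extremalDet_succ (t : ℝ) (k : ℕ) :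
    extremalDet t (k + 1) = (1 + t) * extremalDet t k + t * extremalRootedDet t k := by
  simp only [extremalDet, extremalRootedDet]
  push_cast
  ring

variable {α β t : ℝ}

theorem extremalRootedDet_lt_extremalDet (ht : 0 < t) (k : ℕ) :
    extremalRootedDet t k < extremalDet t k := by
  have hle : extremalRootedDet t k ≤ (1 + t) ^ (k + 2) * (1 + 3 * t) := by
    unfold extremalRootedDet
    gcongr <;> linarith
  have hlt : (1 + t) ^ (k + 2) * (1 + 3 * t) < (1 + t) ^ (k + 2) * (1 + 4 * t) := by
    gcongr
    norm_num
  have hnonneg : 0 ≤ k * t * (1 + t) ^ k * (1 + 3 * t) := by positivity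
  unfold extremalDet
  linarith

theorem exists_sub_eq_one_and_mul_eq (ht : 0 < t) :
    ∃ α β : ℝ, 0 < β ∧ α - β = 1 ∧ α * β = t := by
  have hsqrt : 1 < √(1 + 4 * t) := Real.lt_sqrt_of_sq_lt (by linarith)
  have hsq := Real.sq_sqrt (show 0 ≤ 1 + 4 * t by linarith)
  refine ⟨(√(1 + 4 * t) + 1) / 2, (√(1 + 4 * t) - 1) / 2, by linarith, by ring, ?_⟩
  linear_combination hsq / 4

theorem extremalDet_zero (hsub : α - β = 1) (hmul : α * β = t) :
    extremalDet t 0 = (α ^ 3 + β ^ 3) ^ 2 := by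
  obtain rfl : α = β + 1 := by linarith
  simp only [extremalDet, ← hmul]
  push_cast
  ring

theorem extremalRootedDet_zero (hsub : α - β = 1) (hmul : α * β = t) :
    extremalRootedDet t 0 = ∑ i ∈ range 3, (α ^ 2) ^ i * (β ^ 2) ^ (2 - i) := by
  obtain rfl : α = β + 1 := by linarith
  simp only [extremalRootedDet, ← hmul, sum_range_succ, range_zero, sum_empty]
  ring

section Cycle

variable (hβ : 0 < β) (hsub : α - β = 1) (hmul : α * β = t)

include hβ hsub hmul

theorem extremalRootedDet_succ_lt_geom_sum₂ {k : ℕ}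
    (h : extremalRootedDet t k ≤ ∑ i ∈ range (k + 3), (α ^ 2) ^ i * (β ^ 2) ^ (k + 2 - i)) :
    extremalRootedDet t (k + 1) <
      ∑ i ∈ range (k + 4), (α ^ 2) ^ i * (β ^ 2) ^ (k + 3 - i) := by
  have ht : 0 < t := hmul ▸ mul_pos (by linarith) hβ
  have hα : 1 + t ≤ α ^ 2 := by nlinarith
  have hW : ∑ i ∈ range (k + 4), (α ^ 2) ^ i * (β ^ 2) ^ (k + 3 - i) =
      α ^ 2 * ∑ i ∈ range (k + 3), (α ^ 2) ^ i * (β ^ 2) ^ (k + 2 - i) + (β ^ 2) ^ (k + 3) := by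
    rw [sum_range_succ', mul_sum, pow_zero, one_mul, Nat.sub_zero]
    congr 1
    exact sum_congr rfl fun i _ => by rw [show k + 3 - (i + 1) = k + 2 - i by lia, pow_succ']; ring
  rw [extremalRootedDet_succ, hW]
  have hmain := mul_le_mul hα h (by unfold extremalRootedDet; positivity) (sq_nonneg α)
  have hpos : 0 < (β ^ 2) ^ (k + 3) := by positivity
  linarith

theorem extremalRootedDet_le_geom_sum₂ (k : ℕ) :
    extremalRootedDet t k ≤ ∑ i ∈ range (k + 3), (α ^ 2) ^ i * (β ^ 2) ^ (k + 2 - i) := by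
  induction k with
  | zero => exact (extremalRootedDet_zero hsub hmul).le
  | succ k ih => exact (extremalRootedDet_succ_lt_geom_sum₂ hβ hsub hmul ih).le

theorem extremalRootedDet_add_lt (k : ℕ) :
    extremalRootedDet t k + 2 * t ^ (k + 2) < α ^ (2 * k + 5) - β ^ (2 * k + 5) := by
  have ht : 0 < t := hmul ▸ mul_pos (by linarith) hβ
  have hα : 0 < α := by linarith
  induction k with
  | zero =>
    have hu : α ^ 5 - β ^ 5 = 1 + 5 * t + 5 * t ^ 2 := by
      obtain rfl : α = β + 1 := by linarith
      rw [← hmul]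
      ring
    norm_num [extremalRootedDet, hu]
    linarith
  | succ k ih =>
    have hu : α ^ (2 * k + 7) - β ^ (2 * k + 7) =
        (1 + t) * (α ^ (2 * k + 5) - β ^ (2 * k + 5)) +
          (β * α ^ (2 * k + 5) + α * β ^ (2 * k + 5)) := by
      obtain rfl : α = β + 1 := by linarith
      rw [← hmul]
      ring
    have hpos : 0 < β * α ^ (2 * k + 5) + α * β ^ (2 * k + 5) := by positivity
    have hpow : 0 < t ^ (k + 2) := by positivity
    rw [show 2 * (k + 1) + 5 = 2 * k + 7 by ring, hu, extremalRootedDet_succ]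
    have := mul_lt_mul_of_pos_left ih (show 0 < 1 + t by linarith)
    linear_combination hpos + this + 2 * hpow

theorem extremalDet_succ_lt_sq {k : ℕ} (h : extremalDet t k ≤ (α ^ (k + 3) + β ^ (k + 3)) ^ 2) :
    extremalDet t (k + 1) < (α ^ (k + 4) + β ^ (k + 4)) ^ 2 := by
  have ht : 0 < t := hmul ▸ mul_pos (by linarith) hβ
  have hc : (α ^ (k + 4) + β ^ (k + 4)) ^ 2 = (1 + t) * (α ^ (k + 3) + β ^ (k + 3)) ^ 2 +
      t * (α ^ (2 * k + 5) - β ^ (2 * k + 5)) - 2 * t ^ (k + 3) := by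
    obtain rfl : α = β + 1 := by linarith
    rw [← hmul, mul_pow]
    ring
  have hroot := mul_lt_mul_of_pos_left (extremalRootedDet_add_lt hβ hsub hmul k) ht
  have hmain := mul_le_mul_of_nonneg_left h (show 0 ≤ 1 + t by linarith)
  rw [hc, extremalDet_succ]
  linear_combination hroot + hmain

theorem extremalDet_le_sq (k : ℕ) : extremalDet t k ≤ (α ^ (k + 3) + β ^ (k + 3)) ^ 2 := by
  induction k with
  | zero => exact (extremalDet_zero hsub hmul).le
  | succ k ih => exact (extremalDet_succ_lt_sq hβ hsub hmul ih).le

end Cycle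

section

variable {k : ℕ} (ht : 0 < t) (hk : Even k)

include ht hk

theorem extremalDet_le_rootedDet_cycleGraph :
    extremalDet t k ≤ rootedDet t ∅ (cycleGraph (k + 3)).edgeFinset := by
  obtain ⟨α, β, hβ, hsub, hmul⟩ := exists_sub_eq_one_and_mul_eq ht
  rw [rootedDet_cycleGraph hsub hmul hk]
  exact extremalDet_le_sq hβ hsub hmul k

theorem extremalDet_lt_rootedDet_cycleGraph (hk₀ : k ≠ 0) :
    extremalDet t k < rootedDet t ∅ (cycleGraph (k + 3)).edgeFinset := by
  obtain ⟨α, β, hβ, hsub, hmul⟩ := exists_sub_eq_one_and_mul_eq ht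
  obtain ⟨m, rfl⟩ := Nat.exists_eq_succ_of_ne_zero hk₀
  rw [rootedDet_cycleGraph hsub hmul hk]
  exact extremalDet_succ_lt_sq hβ hsub hmul (extremalDet_le_sq hβ hsub hmul m)

theorem extremalRootedDet_le_rootedDet_cycleGraph (a : Fin (k + 3)) :
    extremalRootedDet t k ≤ rootedDet t {a} (cycleGraph (k + 3)).edgeFinset := by
  obtain ⟨α, β, hβ, hsub, hmul⟩ := exists_sub_eq_one_and_mul_eq ht
  rw [rootedDet_singleton_cycleGraph,
    rootedDet_singleton_last_cycleGraph hsub hmul (by linarith) hβ.le hk]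
  exact extremalRootedDet_le_geom_sum₂ hβ hsub hmul k

theorem extremalRootedDet_lt_rootedDet_cycleGraph (hk₀ : k ≠ 0) (a : Fin (k + 3)) :
    extremalRootedDet t k < rootedDet t {a} (cycleGraph (k + 3)).edgeFinset := by
  obtain ⟨α, β, hβ, hsub, hmul⟩ := exists_sub_eq_one_and_mul_eq ht
  obtain ⟨m, rfl⟩ := Nat.exists_eq_succ_of_ne_zero hk₀
  rw [rootedDet_singleton_cycleGraph,
    rootedDet_singleton_last_cycleGraph hsub hmul (by linarith) hβ.le hk]
  exact extremalRootedDet_succ_lt_geom_sum₂ hβ hsub hmul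
    (extremalRootedDet_le_geom_sum₂ hβ hsub hmul m)

end

theorem rootedDet_cycleGraph_three (ht : 0 < t) :
    rootedDet t ∅ (cycleGraph 3).edgeFinset = extremalDet t 0 := by
  obtain ⟨α, β, -, hsub, hmul⟩ := exists_sub_eq_one_and_mul_eq ht
  rw [rootedDet_cycleGraph hsub hmul Even.zero, extremalDet_zero hsub hmul]

theorem rootedDet_singleton_cycleGraph_three (ht : 0 < t) (a : Fin 3) :
    rootedDet t {a} (cycleGraph 3).edgeFinset = extremalRootedDet t 0 := by
  obtain ⟨α, β, hβ, hsub, hmul⟩ := exists_sub_eq_one_and_mul_eq ht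
  rw [rootedDet_singleton_cycleGraph (n := 0),
    rootedDet_singleton_last_cycleGraph hsub hmul (by linarith) hβ.le Even.zero,
    extremalRootedDet_zero hsub hmul]

end Extremal

section OddCycle

variable {V : Type*} {G : SimpleGraph V} {u v : V}

theorem even_length_add_length_bypass [DecidableEq V]
    (hG : ∀ (w : V) (c : G.Walk w w), c.IsCycle → Even c.length) (p : G.Walk u v) :
    Even (p.length + p.bypass.length) := by
  induction p with
  | nil => simp [Walk.bypass]
  | @cons u w v h p ih =>
    by_cases hu : u ∈ p.bypass.support
    · set q := p.bypass.takeUntil u hu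
      have hq : q.IsPath := p.bypass_isPath.takeUntil hu
      have hlen : p.bypass.length = q.length + (p.bypass.dropUntil u hu).length := by
        rw [← Walk.length_append, Walk.take_spec]
      have hq_pos : q.length ≠ 0 := fun h0 => h.ne' (Walk.eq_of_length_eq_zero h0)
      have hq_odd : Even (q.length + 1) := by
        rcases eq_or_ne q.length 1 with h1 | h1
        · simp [h1]
        · refine hG u (q.cons h)
            (Walk.isCycle_iff_isPath_tail_and_le_length.2 ⟨by simpa using hq, ?_⟩)
          rw [Walk.length_cons]
          lia
      simp only [Walk.bypass, hu, dite_true, Walk.length_cons]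
      grind
    · simp only [Walk.bypass, hu, dite_false, Walk.length_cons]
      grind

theorem exists_odd_isCycle_of_not_isBipartite (hG : ¬ G.IsBipartite) :
    ∃ (u : V) (c : G.Walk u u), c.IsCycle ∧ Odd c.length := by
  classical
  by_contra! hodd
  refine hG (two_colorable_iff_forall_loop_even.2 fun u c => ?_)
  have hbypass : c.bypass = Walk.nil := (Walk.isPath_iff_nil.1 c.bypass_isPath).eq_nil
  simpa [hbypass] using
    even_length_add_length_bypass (fun w c hc => Nat.not_odd_iff_even.1 (hodd w c hc)) c

theorem exists_even_cycleGraph_isContained (hG : ¬ G.IsBipartite) :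
    ∃ k, Even k ∧ cycleGraph (k + 3) ⊑ G := by
  obtain ⟨u, c, hc, hodd⟩ := exists_odd_isCycle_of_not_isBipartite hG
  obtain ⟨k, hk⟩ := Nat.exists_eq_add_of_le' hc.three_le_length
  refine ⟨k, by grind, (cycleGraph_isContained_iff (by lia)).2 ⟨u, c, hc, hk⟩⟩

end OddCycle

section Growth

variable {V : Type*} [DecidableEq V] [Fintype V] {G : SimpleGraph V}

theorem finset_univ_of_connected (hG : G.Connected) {P : Finset V → Prop} {S₀ : Finset V}
    (hne : S₀.Nonempty) (base : P S₀)
    (step : ∀ S, ∀ a ∈ S, ∀ v ∉ S, G.Adj a v → P S → P (insert v S)) : P univ := by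
  obtain ⟨S, hS₀, hS⟩ := Finite.exists_le_maximal base
  suffices S = univ from this ▸ hS.prop
  by_contra hSuniv
  obtain ⟨b, hb⟩ := hne
  obtain ⟨c, hc⟩ : ∃ c, c ∉ S := by simpa [eq_univ_iff_forall] using hSuniv
  obtain ⟨p⟩ := hG b c
  obtain ⟨d, -, hfst, hsnd⟩ := p.exists_boundary_dart S (hS₀ hb) hc
  exact hsnd (hS.le_of_ge (step S d.fst hfst d.snd hsnd d.adj hS.prop) (subset_insert _ _)
    (mem_insert_self _ _))

variable [DecidableRel G.Adj] {t : ℝ} {k : ℕ} {S R : Finset V} {a b v : V}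

/-- The invariant of the growth of an odd cycle to a spanning connected subgraph: the determinant of
the subgraph of `G` induced by the `k + 3` vertices of `S`, and each of its principal cofactors, is
bounded below by its extremal value, which is attained only if some vertex, respectively the
vertex defining the cofactor, is adjacent to the rest of `S`. -/
structure ExtremalOn (G : SimpleGraph V) [DecidableRel G.Adj] (t : ℝ) (k : ℕ) (S : Finset V) :
    Prop where
  card_eq : #S = k + 3
  le_det : extremalDet t k ≤ rootedDet t ∅ (G.edgeFinset ∩ S.sym2)
  exists_adj_of_det_eq : rootedDet t ∅ (G.edgeFinset ∩ S.sym2) = extremalDet t k →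
    ∃ z ∈ S, ∀ b ∈ S, z ≠ b → G.Adj z b
  le_rootedDet : ∀ a ∈ S, extremalRootedDet t k ≤ rootedDet t {a} (G.edgeFinset ∩ S.sym2)
  adj_of_rootedDet_eq : ∀ a ∈ S, rootedDet t {a} (G.edgeFinset ∩ S.sym2) = extremalRootedDet t k →
    ∀ b ∈ S, a ≠ b → G.Adj a b

theorem extremalOn_map_cycleGraph (ht : 0 < t) (hk : Even k) (f : Copy (cycleGraph (k + 3)) G) :
    ExtremalOn G t k (univ.map f.toEmbedding) := by
  set S := univ.map f.toEmbedding
  have hsub : (cycleGraph (k + 3)).edgeFinset.map f.toEmbedding.sym2Map ⊆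
      G.edgeFinset ∩ S.sym2 := by
    intro e he
    obtain ⟨e', he', rfl⟩ := mem_map.1 he
    exact mem_inter.2 ⟨mem_edgeFinset.2 (f.toHom.map_mem_edgeSet (mem_edgeFinset.1 he')),
      mem_sym2_iff.2 fun x hx => by
        obtain ⟨y, -, rfl⟩ := Sym2.mem_map.1 hx
        exact mem_map_of_mem _ (mem_univ y)⟩
  have hmono : ∀ R, rootedDet t R (cycleGraph (k + 3)).edgeFinset ≤
      rootedDet t (R.map f.toEmbedding) (G.edgeFinset ∩ S.sym2) := fun R => by
    rw [← rootedDet_map f.toEmbedding]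
    exact rootedDet_mono ht.le _ hsub
  have hroot : ∀ i, rootedDet t {i} (cycleGraph (k + 3)).edgeFinset ≤
      rootedDet t {f i} (G.edgeFinset ∩ S.sym2) := fun i => hmono {i}
  have hadj (h0 : k = 0) : ∀ a ∈ S, ∀ b ∈ S, a ≠ b → G.Adj a b := by
    subst h0
    simp only [S, forall_mem_map, mem_univ, true_imp_iff]
    intro i j hij
    exact f.toHom.map_adj (cycleGraph_three_eq_top ▸ fun h => hij (congrArg _ h))
  refine ⟨by simp [S], (extremalDet_le_rootedDet_cycleGraph ht hk).trans (hmono ∅), fun heq => ?_,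
    forall_mem_map.2 fun i _ => ?_, forall_mem_map.2 fun i _ heq => ?_⟩
  · have h0 : k = 0 := of_not_not fun h0 =>
      ((extremalDet_lt_rootedDet_cycleGraph ht hk h0).trans_le (hmono ∅)).ne' heq
    exact ⟨f 0, mem_map_of_mem _ (mem_univ 0), hadj h0 _ (mem_map_of_mem _ (mem_univ 0))⟩
  · exact (extremalRootedDet_le_rootedDet_cycleGraph ht hk i).trans (hroot i)
  · have h0 : k = 0 := of_not_not fun h0 =>
      ((extremalRootedDet_lt_rootedDet_cycleGraph ht hk h0 i).trans_le (hroot i)).ne' heq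
    exact hadj h0 _ (mem_map_of_mem _ (mem_univ i))

theorem insert_edge_subset (ha : a ∈ S) (hav : G.Adj a v) :
    insert s(v, a) (G.edgeFinset ∩ S.sym2) ⊆ G.edgeFinset ∩ (insert v S).sym2 := by
  refine insert_subset ?_ (inter_subset_inter_left (sym2_mono (subset_insert v S)))
  simp [hav.symm, ha]

theorem notMem_of_mem_edgeFinset_inter_sym2 (hv : v ∉ S) :
    ∀ e ∈ G.edgeFinset ∩ S.sym2, v ∉ e := fun _ he hve =>
  hv (mem_sym2_iff.1 (mem_inter.1 he).2 v hve)

theorem ExtremalOn.lt_rootedDet_insert (hS : ExtremalOn G t k S) (ht : 0 < t) (ha : a ∈ S)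
    (hv : v ∉ S) (hav : G.Adj a v) (hb : b ∈ insert v S) (hba : b ≠ a) :
    extremalRootedDet t (k + 1) < rootedDet t {b} (G.edgeFinset ∩ (insert v S).sym2) := by
  have hE := notMem_of_mem_edgeFinset_inter_sym2 (G := G) hv
  have hE' := insert_edge_subset ha hav
  rw [extremalRootedDet_succ]
  rcases mem_insert.1 hb with rfl | hb
  · have hdet := add_le_rootedDet_of_rooted_pendant hE ht.le hav.ne (notMem_empty a) hE'
    have hroot := mul_le_mul_of_nonneg_left (hS.le_rootedDet a ha) ht.le
    simp only [insert_empty_eq] at hdet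
    linarith [hS.le_det, extremalRootedDet_lt_extremalDet ht k]
  · have hvb : v ∉ ({b} : Finset V) := by
      rw [mem_singleton]
      rintro rfl
      exact hv hb
    have hdet := add_le_rootedDet_of_pendant hE ht.le hav.ne hvb (by simpa using hba.symm) hE'
    have hroot := mul_le_mul_of_nonneg_left (hS.le_rootedDet b hb) (show 0 ≤ 1 + t by linarith)
    have hpos := mul_pos ht (rootedDet_pos ht.le {a, b} (G.edgeFinset ∩ S.sym2))
    linarith

theorem ExtremalOn.insert_vertex (hS : ExtremalOn G t k S) (ht : 0 < t) (ha : a ∈ S) (hv : v ∉ S)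
    (hav : G.Adj a v) : ExtremalOn G t (k + 1) (insert v S) := by
  have hE := notMem_of_mem_edgeFinset_inter_sym2 (G := G) hv
  have hE' := insert_edge_subset ha hav
  have hdet := add_le_rootedDet_of_pendant hE ht.le hav.ne (notMem_empty v) (notMem_empty a) hE'
  have hroot := mul_le_rootedDet_of_pendant_of_mem hE ht.le hav.ne (by simpa using hav.ne')
    (mem_singleton_self a) hE'
  rw [insert_empty_eq] at hdet
  have hle_det := mul_le_mul_of_nonneg_left hS.le_det (show 0 ≤ 1 + t by linarith)
  have hle_root := hS.le_rootedDet a ha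
  have hdominates (heq : rootedDet t {a} (G.edgeFinset ∩ S.sym2) ≤ extremalRootedDet t k) :
      ∀ b ∈ insert v S, a ≠ b → G.Adj a b :=
    (forall_mem_insert ..).2 ⟨fun _ => hav, hS.adj_of_rootedDet_eq a ha (heq.antisymm hle_root)⟩
  refine ⟨by rw [card_insert_of_notMem hv, hS.card_eq], ?_, fun heq => ?_, fun b hb => ?_,
    fun b hb heq => ?_⟩
  · rw [extremalDet_succ]
    nlinarith
  · refine ⟨a, mem_insert_of_mem ha, hdominates (le_of_mul_le_mul_left ?_ ht)⟩
    rw [extremalDet_succ] at heq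
    linarith
  · rcases eq_or_ne b a with rfl | hba
    · rw [extremalRootedDet_succ]
      nlinarith
    · exact (hS.lt_rootedDet_insert ht ha hv hav hb hba).le
  · rcases eq_or_ne b a with rfl | hba
    · refine hdominates (le_of_mul_le_mul_left (hroot.trans_eq ?_) (by linarith : 0 < 1 + t))
      rw [heq, extremalRootedDet_succ]
    · exact absurd heq (hS.lt_rootedDet_insert ht ha hv hav hb hba).ne'

theorem extremalOn_univ (hG : G.Connected) (hbip : ¬ G.IsBipartite)
    (hV : Fintype.card V = k + 3) (ht : 0 < t) : ExtremalOn G t k univ := by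
  obtain ⟨m, hm, ⟨f⟩⟩ := exists_even_cycleGraph_isContained hbip
  obtain ⟨k', hk'⟩ : ∃ k, ExtremalOn G t k univ :=
    finset_univ_of_connected (P := fun S => ∃ k, ExtremalOn G t k S) hG
      (map_nonempty.2 univ_nonempty) ⟨m, extremalOn_map_cycleGraph ht hm f⟩
      fun S a ha v hv hav ⟨k, hS⟩ => ⟨k + 1, hS.insert_vertex ht ha hv hav⟩
  have := hk'.card_eq
  obtain rfl : k' = k := by rw [card_univ] at this; lia
  exact hk'

end Growth

section TrianglePendant

variable {k : ℕ}

@[simp]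
theorem trianglePendant_adj_inl_inl {a b : Fin 3} :
    (trianglePendant k).Adj (.inl a) (.inl b) ↔ a ≠ b := Iff.rfl

@[simp]
theorem trianglePendant_adj_inl_inr {a : Fin 3} {b : Fin k} :
    (trianglePendant k).Adj (.inl a) (.inr b) ↔ a = 2 := Iff.rfl

@[simp]
theorem trianglePendant_adj_inr_inl {a : Fin k} {b : Fin 3} :
    (trianglePendant k).Adj (.inr a) (.inl b) ↔ b = 2 := Iff.rfl

@[simp]
theorem trianglePendant_adj_inr_inr {a b : Fin k} :
    ¬ (trianglePendant k).Adj (.inr a) (.inr b) := id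

theorem connected_trianglePendant (k : ℕ) : (trianglePendant k).Connected :=
  (connected_iff_exists_forall_reachable _).2 ⟨.inl 2, by
    rintro (a | a)
    · rcases eq_or_ne 2 a with rfl | ha
      · rfl
      · exact (trianglePendant_adj_inl_inl.2 ha).reachable
    · exact (trianglePendant_adj_inl_inr.2 rfl).reachable⟩

theorem girth_trianglePendant (k : ℕ) : (trianglePendant k).girth = 3 := by
  have htriangle : (⊤ : SimpleGraph (Fin 3)) ⊑ trianglePendant k :=
    ⟨⟨⟨Sum.inl, fun h => h⟩, Sum.inl_injective⟩⟩
  have hle : (trianglePendant k).egirth ≤ 3 := htriangle.egirth_le.trans_eq (egirth_top (by simp))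
  rw [girth, hle.antisymm (trianglePendant k).three_le_egirth]
  rfl

/-- The inclusion of the vertices of `trianglePendant k` into those of `trianglePendant (k + 1)`
which misses the last pendent vertex. -/
def trianglePendantEmb (k : ℕ) : Fin 3 ⊕ Fin k ↪ Fin 3 ⊕ Fin (k + 1) :=
  (Function.Embedding.refl _).sumMap Fin.castSuccEmb

theorem edgeFinset_trianglePendant_succ :
    (trianglePendant (k + 1)).edgeFinset = insert s(.inr (Fin.last k), .inl 2)
      ((trianglePendant k).edgeFinset.map (trianglePendantEmb k).sym2Map) := by
  ext e
  induction e with | _ x y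
  rw [mem_edgeFinset, mem_insert]
  have hmap : s(x, y) ∈ (trianglePendant k).edgeFinset.map (trianglePendantEmb k).sym2Map ↔
      ((trianglePendant k).map (trianglePendantEmb k)).Adj x y := by
    rw [← mem_edgeSet, edgeSet_map, ← coe_edgeFinset, ← coe_map, mem_coe]
  rw [hmap, map_adj]
  rcases x with x | x <;> rcases y with y | y
  · simp [trianglePendantEmb]
  · cases y using Fin.lastCases <;> simp [trianglePendantEmb, eq_comm]
  · cases x using Fin.lastCases <;> simp [trianglePendantEmb, eq_comm]
  · simp [trianglePendantEmb]

/-- Without pendent vertices, `trianglePendant 0` is the triangle. -/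
def trianglePendantZeroIso : trianglePendant 0 ≃g cycleGraph 3 where
  toEquiv := Equiv.sumEmpty (Fin 3) (Fin 0)
  map_rel_iff' {x y} := by
    rcases x with x | x
    · rcases y with y | y
      · simp [cycleGraph_three_eq_top]
      · exact y.elim0
    · exact x.elim0

theorem last_notMem_of_mem_map_edgeFinset :
    ∀ e ∈ (trianglePendant k).edgeFinset.map (trianglePendantEmb k).sym2Map,
      .inr (Fin.last k) ∉ e := fun e he hlast => by
  obtain ⟨e, -, rfl⟩ := mem_map.1 he
  obtain ⟨x | x, -, hx⟩ := Sym2.mem_map.1 hlast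
  · simp [trianglePendantEmb] at hx
  · simp [trianglePendantEmb, Fin.castSucc_ne_last] at hx

theorem card_edgeFinset_trianglePendant (k : ℕ) : #(trianglePendant k).edgeFinset = k + 3 := by
  induction k with
  | zero => decide
  | succ k ih =>
    rw [edgeFinset_trianglePendant_succ, card_insert_of_notMem fun h =>
      last_notMem_of_mem_map_edgeFinset _ h (Sym2.mem_mk_left _ _), card_map, ih]

theorem isUnicyclic_trianglePendant (k : ℕ) : (trianglePendant k).IsUnicyclic := by
  refine ⟨connected_trianglePendant k, ?_⟩
  rw [← coe_edgeFinset, Set.ncard_coe_finset, card_edgeFinset_trianglePendant]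
  simp [add_comm]

theorem rootedDet_singleton_trianglePendant {t : ℝ} (ht : 0 < t) (k : ℕ) :
    rootedDet t {.inl 2} (trianglePendant k).edgeFinset = extremalRootedDet t k := by
  induction k with
  | zero =>
    rw [← rootedDet_edgeFinset_iso trianglePendantZeroIso, map_singleton,
      rootedDet_singleton_cycleGraph_three ht]
  | succ k ih =>
    have hmap := rootedDet_map (trianglePendantEmb k) t {.inl 2} (trianglePendant k).edgeFinset
    rw [edgeFinset_trianglePendant_succ, rootedDet_insert_pendant_of_mem
      last_notMem_of_mem_map_edgeFinset ht.le (by simp) (by simp) (by simp),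
      extremalRootedDet_succ, ← ih, ← hmap]
    rfl

theorem rootedDet_trianglePendant {t : ℝ} (ht : 0 < t) (k : ℕ) :
    rootedDet t ∅ (trianglePendant k).edgeFinset = extremalDet t k := by
  induction k with
  | zero =>
    rw [← rootedDet_edgeFinset_iso trianglePendantZeroIso, map_empty,
      rootedDet_cycleGraph_three ht]
  | succ k ih =>
    have hmap := rootedDet_map (trianglePendantEmb k) t
    rw [edgeFinset_trianglePendant_succ, rootedDet_insert_pendant
      last_notMem_of_mem_map_edgeFinset ht.le (by simp) (by simp) (by simp),
      extremalDet_succ, ← ih, ← rootedDet_singleton_trianglePendant ht, ← hmap, ← hmap]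
    rfl

variable {V : Type*} {G : SimpleGraph V} {z : V}

theorem exists_adj_of_not_isBipartite (hG : ¬ G.IsBipartite) (z : V) :
    ∃ x y, G.Adj x y ∧ x ≠ z ∧ y ≠ z := by
  classical
  by_contra! h
  refine hG ⟨Coloring.mk (fun x => if x = z then (0 : Fin 2) else 1) fun {x y} hxy => ?_⟩
  have := hxy.ne
  grind

variable [Fintype V]

theorem exists_equiv_forall_inl_eq (hV : Fintype.card V = k + 3) {f : Fin 3 → V}
    (hf : f.Injective) : ∃ φ : Fin 3 ⊕ Fin k ≃ V, ∀ i, φ (.inl i) = f i := by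
  classical
  have hcard : Fintype.card (Fin k) = Fintype.card ↥(Set.range f)ᶜ := by
    rw [Fintype.card_compl_set, Set.card_range_of_injective hf, hV, Fintype.card_fin,
      Fintype.card_fin, Nat.add_sub_cancel]
  exact ⟨((Equiv.ofInjective f hf).sumCongr (Fintype.equivOfCardEq hcard)).trans
    (Equiv.Set.sumCompl (Set.range f)), fun i => rfl⟩

theorem exists_equiv_trianglePendant_map_le (hG : ¬ G.IsBipartite) (hV : Fintype.card V = k + 3)
    (hz : ∀ b, z ≠ b → G.Adj z b) :
    ∃ φ : Fin 3 ⊕ Fin k ≃ V, (trianglePendant k).map φ.toEmbedding ≤ G := by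
  obtain ⟨x, y, hxy, hxz, hyz⟩ := exists_adj_of_not_isBipartite hG z
  have hadj : ∀ i j, i ≠ j → G.Adj (![x, y, z] i) (![x, y, z] j) := by
    have hzx := hz x hxz.symm
    have hzy := hz y hyz.symm
    intro i j hij
    fin_cases i <;> fin_cases j <;> simp_all [adj_comm]
  have hinj : Function.Injective ![x, y, z] := fun i j hij =>
    of_not_not fun hne => (hadj i j hne).ne hij
  obtain ⟨φ, hφ⟩ := exists_equiv_forall_inl_eq hV hinj
  have hpendant (i : Fin k) : G.Adj (φ (.inl 2)) (φ (.inr i)) := by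
    rw [hφ]
    exact hz _ fun h => Sum.inl_ne_inr (φ.injective ((hφ 2).trans h))
  refine ⟨φ, (SimpleGraph.map_le_iff_le_comap ..).2 ?_⟩
  rintro (i | i) (j | j) hij
  · simpa only [comap_adj, Equiv.coe_toEmbedding, hφ] using hadj i j hij
  · exact trianglePendant_adj_inl_inr.1 hij ▸ hpendant j
  · exact trianglePendant_adj_inr_inl.1 hij ▸ (hpendant i).symm
  · exact hij.elim

variable [DecidableEq V] [DecidableRel G.Adj] {t : ℝ}

theorem nonempty_iso_trianglePendant_of_adj (hG : ¬ G.IsBipartite)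
    (hV : Fintype.card V = k + 3) (hz : ∀ b, z ≠ b → G.Adj z b) (ht : 0 < t)
    (hdet : rootedDet t ∅ G.edgeFinset ≤ extremalDet t k) :
    Nonempty (G ≃g trianglePendant k) := by
  classical
  obtain ⟨φ, hφ⟩ := exists_equiv_trianglePendant_map_le hG hV hz
  rcases hφ.eq_or_lt with heq | hlt
  · exact ⟨heq ▸ (Iso.map φ (trianglePendant k)).symm⟩
  · have hiso := rootedDet_edgeFinset_iso (Iso.map φ (trianglePendant k)) t ∅
    rw [map_empty, rootedDet_trianglePendant ht] at hiso
    exact absurd (hdet.trans_eq hiso.symm)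
      (rootedDet_empty_strictMono ht (edgeFinset_ssubset_edgeFinset.2 hlt)).not_ge

theorem extremalDet_le_rootedDet_edgeFinset (hG : G.Connected) (hbip : ¬ G.IsBipartite)
    (hV : Fintype.card V = k + 3) (ht : 0 < t) :
    extremalDet t k ≤ rootedDet t ∅ G.edgeFinset := by
  simpa using (extremalOn_univ hG hbip hV ht).le_det

theorem nonempty_iso_trianglePendant_of_rootedDet_eq (hG : G.Connected) (hbip : ¬ G.IsBipartite)
    (hV : Fintype.card V = k + 3) (ht : 0 < t)
    (heq : rootedDet t ∅ G.edgeFinset = extremalDet t k) : Nonempty (G ≃g trianglePendant k) := by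
  obtain ⟨z, -, hz⟩ := (extremalOn_univ hG hbip hV ht).exists_adj_of_det_eq (by simpa using heq)
  exact nonempty_iso_trianglePendant_of_adj hbip hV (fun b => hz b (mem_univ b)) ht heq.le

end TrianglePendant

section SqrtPrimitive

/-- An antiderivative of `log (1 + ν s ^ 2) / s ^ 2`, which vanishes at `0` and tends to `π √ν`
at infinity. -/
noncomputable def sqrtPrimitive (ν s : ℝ) : ℝ :=
  2 * √ν * Real.arctan (√ν * s) - Real.log (1 + ν * s ^ 2) / s

variable {ν : ℝ}

theorem hasDerivAt_sqrtPrimitive {s : ℝ} (hν : 0 ≤ ν) (hs : 0 < s) :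
    HasDerivAt (sqrtPrimitive ν) (Real.log (1 + ν * s ^ 2) / s ^ 2) s := by
  have hpos : 0 < 1 + ν * s ^ 2 := by positivity
  have hlinear : HasDerivAt (fun s => √ν * s) √ν s := by
    simpa using (hasDerivAt_id s).const_mul √ν
  have hquadratic : HasDerivAt (fun s => 1 + ν * s ^ 2) (ν * (2 * s)) s := by
    simpa using ((hasDerivAt_pow 2 s).const_mul ν).const_add 1
  refine ((hlinear.arctan.const_mul (2 * √ν)).sub
    ((hquadratic.log hpos.ne').div (hasDerivAt_id s) hs.ne')).congr_deriv ?_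
  simp only [mul_pow, Real.sq_sqrt hν, id]
  field_simp
  rw [Real.sq_sqrt hν]
  ring

theorem log_one_add_mul_sq_div_nonneg {s : ℝ} (hν : 0 ≤ ν) (hs : 0 < s) :
    0 ≤ Real.log (1 + ν * s ^ 2) / s :=
  div_nonneg (Real.log_nonneg (le_add_of_nonneg_right (by positivity))) hs.le

theorem tendsto_log_one_add_mul_sq_div_atTop (hν : 0 ≤ ν) :
    Tendsto (fun s : ℝ => Real.log (1 + ν * s ^ 2) / s) atTop (𝓝 0) := by
  have hbound : Tendsto (fun s : ℝ => Real.log (1 + ν) / s + 2 * (Real.log s / s)) atTop (𝓝 0) := by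
    have hlog : Tendsto (fun s : ℝ => Real.log s / s) atTop (𝓝 0) := by
      simpa using Real.tendsto_pow_log_div_mul_add_atTop 1 0 1 one_ne_zero
    simpa using (tendsto_const_nhds.div_atTop tendsto_id).add (hlog.const_mul 2)
  refine squeeze_zero' ?_ ?_ hbound
  · filter_upwards [eventually_gt_atTop 0] with s hs using log_one_add_mul_sq_div_nonneg hν hs
  · filter_upwards [eventually_ge_atTop 1] with s hs
    have : 0 < s := by linarith
    calc Real.log (1 + ν * s ^ 2) / s ≤ Real.log ((1 + ν) * s ^ 2) / s := by
          gcongr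
          nlinarith
      _ = Real.log (1 + ν) / s + 2 * (Real.log s / s) := by
          rw [Real.log_mul (by positivity) (by positivity), Real.log_pow]
          push_cast
          ring

theorem tendsto_log_one_add_mul_sq_div_nhdsGT_zero (hν : 0 ≤ ν) :
    Tendsto (fun s : ℝ => Real.log (1 + ν * s ^ 2) / s) (𝓝[>] 0) (𝓝 0) := by
  have hbound : Tendsto (fun s : ℝ => ν * s) (𝓝[>] 0) (𝓝 0) := by
    simpa using ((continuous_const_mul ν).tendsto 0).mono_left nhdsWithin_le_nhds
  refine squeeze_zero' ?_ ?_ hbound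
  · filter_upwards [self_mem_nhdsWithin] with s hs using log_one_add_mul_sq_div_nonneg hν hs
  · filter_upwards [self_mem_nhdsWithin] with s hs
    rw [Set.mem_Ioi] at hs
    rw [div_le_iff₀ hs]
    linarith [Real.log_le_sub_one_of_pos (show 0 < 1 + ν * s ^ 2 by positivity)]

theorem tendsto_sqrtPrimitive_atTop (hν : 0 ≤ ν) :
    Tendsto (sqrtPrimitive ν) atTop (𝓝 (Real.pi * √ν)) := by
  have harctan : Tendsto (fun s => 2 * √ν * Real.arctan (√ν * s)) atTop (𝓝 (Real.pi * √ν)) := by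
    rcases hν.eq_or_lt with rfl | hν
    · simp
    · have hlinear : Tendsto (fun s : ℝ => √ν * s) atTop atTop :=
        tendsto_id.const_mul_atTop (Real.sqrt_pos.2 hν)
      have hhalf := (Real.tendsto_arctan_atTop.mono_right nhdsWithin_le_nhds).comp hlinear
      rw [show Real.pi * √ν = 2 * √ν * (Real.pi / 2) by ring]
      exact hhalf.const_mul (2 * √ν)
  rw [← sub_zero (Real.pi * √ν)]
  exact harctan.sub (tendsto_log_one_add_mul_sq_div_atTop hν)

theorem tendsto_sqrtPrimitive_nhdsGT_zero (hν : 0 ≤ ν) :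
    Tendsto (sqrtPrimitive ν) (𝓝[>] 0) (𝓝 0) := by
  have harctan : Tendsto (fun s => 2 * √ν * Real.arctan (√ν * s)) (𝓝[>] 0) (𝓝 0) := by
    have hcont : Continuous fun s => 2 * √ν * Real.arctan (√ν * s) := by fun_prop
    simpa using (hcont.tendsto 0).mono_left nhdsWithin_le_nhds
  have hsub := harctan.sub (tendsto_log_one_add_mul_sq_div_nhdsGT_zero hν)
  rwa [sub_zero] at hsub

end SqrtPrimitive

section SumSqrt

variable {ι κ : Type*} [Fintype ι] [Fintype κ] {μ : ι → ℝ} {ν : κ → ℝ} {s : ℝ}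

theorem prod_one_add_mul_pos {t : ℝ} (hμ : ∀ i, 0 ≤ μ i) (ht : 0 ≤ t) :
    0 < ∏ i, (1 + t * μ i) :=
  prod_pos fun i _ => by linarith [mul_nonneg ht (hμ i)]

theorem hasDerivAt_sum_sqrtPrimitive (hμ : ∀ i, 0 ≤ μ i) (hs : 0 < s) :
    HasDerivAt (fun s => ∑ i, sqrtPrimitive (μ i) s)
      (Real.log (∏ i, (1 + s ^ 2 * μ i)) / s ^ 2) s := by
  refine (HasDerivAt.fun_sum fun i _ => hasDerivAt_sqrtPrimitive (hμ i) hs).congr_deriv ?_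
  rw [Real.log_prod fun i _ => by have := hμ i; positivity, sum_div]
  simp only [mul_comm]

theorem tendsto_sum_sqrtPrimitive_atTop (hμ : ∀ i, 0 ≤ μ i) :
    Tendsto (fun s => ∑ i, sqrtPrimitive (μ i) s) atTop (𝓝 (Real.pi * ∑ i, √(μ i))) := by
  rw [mul_sum]
  exact tendsto_finsetSum _ fun i _ => tendsto_sqrtPrimitive_atTop (hμ i)

theorem tendsto_sum_sqrtPrimitive_nhdsGT_zero (hμ : ∀ i, 0 ≤ μ i) :
    Tendsto (fun s => ∑ i, sqrtPrimitive (μ i) s) (𝓝[>] 0) (𝓝 0) := by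
  simpa using tendsto_finsetSum univ fun i _ => tendsto_sqrtPrimitive_nhdsGT_zero (hμ i)

variable (hμ : ∀ i, 0 ≤ μ i) (hν : ∀ i, 0 ≤ ν i)

include hμ hν

theorem hasDerivAt_sum_sqrtPrimitive_sub (hs : 0 < s) :
    HasDerivAt (fun s => ∑ i, sqrtPrimitive (ν i) s - ∑ i, sqrtPrimitive (μ i) s)
      ((Real.log (∏ i, (1 + s ^ 2 * ν i)) - Real.log (∏ i, (1 + s ^ 2 * μ i))) / s ^ 2) s := by
  rw [sub_div]
  exact (hasDerivAt_sum_sqrtPrimitive hν hs).sub (hasDerivAt_sum_sqrtPrimitive hμ hs)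

variable (hprod : ∀ t : ℝ, 0 < t → ∏ i, (1 + t * μ i) ≤ ∏ i, (1 + t * ν i))

include hprod

theorem monotoneOn_sum_sqrtPrimitive_sub :
    MonotoneOn (fun s => ∑ i, sqrtPrimitive (ν i) s - ∑ i, sqrtPrimitive (μ i) s) (Set.Ioi 0) := by
  have hderiv := fun s hs => hasDerivAt_sum_sqrtPrimitive_sub hμ hν (s := s) hs
  refine monotoneOn_of_hasDerivWithinAt_nonneg (convex_Ioi 0)
    (fun s hs => (hderiv s hs).continuousAt.continuousWithinAt)
    (fun s hs => (hderiv s (interior_subset hs)).hasDerivWithinAt) fun s hs => ?_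
  have hs_sq : 0 < s ^ 2 := pow_pos (interior_subset hs) 2
  have hlog := Real.log_le_log (prod_one_add_mul_pos hμ hs_sq.le) (hprod (s ^ 2) hs_sq)
  exact div_nonneg (sub_nonneg.2 hlog) hs_sq.le

theorem sum_sqrtPrimitive_sub_mem_Icc (hs : 0 < s) :
    ∑ i, sqrtPrimitive (ν i) s - ∑ i, sqrtPrimitive (μ i) s ∈
      Set.Icc 0 (Real.pi * (∑ i, √(ν i) - ∑ i, √(μ i))) := by
  have hmono := monotoneOn_sum_sqrtPrimitive_sub hμ hν hprod
  have hzero := (tendsto_sum_sqrtPrimitive_nhdsGT_zero hν).sub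
    (tendsto_sum_sqrtPrimitive_nhdsGT_zero hμ)
  have htop := (tendsto_sum_sqrtPrimitive_atTop hν).sub (tendsto_sum_sqrtPrimitive_atTop hμ)
  rw [sub_zero] at hzero
  rw [← mul_sub] at htop
  constructor
  · refine le_of_tendsto hzero ?_
    filter_upwards [Ioo_mem_nhdsGT hs] with r hr using hmono hr.1 hs hr.2.le
  · refine ge_of_tendsto htop ?_
    filter_upwards [eventually_ge_atTop s] with r hr using hmono hs (hs.trans_le hr) hr

theorem sum_sqrt_le_sum_sqrt : ∑ i, √(μ i) ≤ ∑ i, √(ν i) := by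
  have hmem := sum_sqrtPrimitive_sub_mem_Icc hμ hν hprod one_pos
  exact sub_nonneg.1 (nonneg_of_mul_nonneg_right (hmem.1.trans hmem.2) Real.pi_pos)

theorem prod_eq_of_sum_sqrt_eq (heq : ∑ i, √(ν i) = ∑ i, √(μ i)) {t : ℝ} (ht : 0 < t) :
    ∏ i, (1 + t * ν i) = ∏ i, (1 + t * μ i) := by
  have hs : 0 < √t := Real.sqrt_pos.2 ht
  have hconst : (fun s => ∑ i, sqrtPrimitive (ν i) s - ∑ i, sqrtPrimitive (μ i) s) =ᶠ[𝓝 √t]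
      fun _ => 0 := by
    filter_upwards [Ioi_mem_nhds hs] with s hs
    simpa [heq] using sum_sqrtPrimitive_sub_mem_Icc hμ hν hprod hs
  have hderiv := (hasDerivAt_sum_sqrtPrimitive_sub hμ hν hs).unique
    ((hasDerivAt_const √t (0 : ℝ)).congr_of_eventuallyEq hconst)
  rw [Real.sq_sqrt ht.le, div_eq_zero_iff, or_iff_left ht.ne', sub_eq_zero] at hderiv
  exact Real.log_injOn_pos (prod_one_add_mul_pos hν ht.le) (prod_one_add_mul_pos hμ ht.le) hderiv

end SumSqrt

section IncidenceEnergy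

variable {V W : Type*} [Fintype V] [DecidableEq V] [Fintype W] [DecidableEq W]

theorem prod_one_add_mul_eigenvalues {A : Matrix V V ℝ} (hA : A.IsHermitian) (t : ℝ) :
    ∏ i, (1 + t * hA.eigenvalues i) = (1 + t • A).det := by
  have hdiag : 1 + t • A = Unitary.conjStarAlgAut ℝ _ hA.eigenvectorUnitary
      (diagonal fun i => 1 + t * hA.eigenvalues i) := by
    have hsplit : (diagonal fun i => 1 + t * hA.eigenvalues i) =
        1 + t • diagonal (RCLike.ofReal ∘ hA.eigenvalues) := by
      rw [← diagonal_one, ← diagonal_smul, diagonal_add]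
      rfl
    rw [hsplit, map_add, map_one, map_smul, ← hA.spectral_theorem]
  rw [hdiag, Unitary.conjStarAlgAut_apply, det_mul_right_comm, Unitary.mul_star_self_of_mem,
    one_mul, det_diagonal]
  exact SetLike.coe_mem _

theorem prod_one_add_mul_eigenvalues_signlessLapMatrix (G : SimpleGraph V) [DecidableRel G.Adj]
    (t : ℝ) : ∏ i, (1 + t * G.isHermitian_signlessLapMatrix.eigenvalues i) =
      rootedDet t ∅ G.edgeFinset := by
  rw [prod_one_add_mul_eigenvalues, det_one_add_smul_signlessLapMatrix]

theorem posSemidef_signlessLapMatrix (G : SimpleGraph V) [DecidableRel G.Adj] :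
    G.signlessLapMatrix.PosSemidef :=
  signlessLapMatrix_eq_rootedSignlessLap G ▸ posSemidef_rootedSignlessLap

variable {G : SimpleGraph V} [DecidableRel G.Adj] {H : SimpleGraph W} [DecidableRel H.Adj]

theorem incidenceEnergy_le
    (h : ∀ t, 0 < t → rootedDet t ∅ G.edgeFinset ≤ rootedDet t ∅ H.edgeFinset) :
    G.incidenceEnergy ≤ H.incidenceEnergy := by
  simp only [← prod_one_add_mul_eigenvalues_signlessLapMatrix] at h
  exact sum_sqrt_le_sum_sqrt (posSemidef_signlessLapMatrix G).eigenvalues_nonneg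
    (posSemidef_signlessLapMatrix H).eigenvalues_nonneg h

theorem rootedDet_eq_of_incidenceEnergy_eq
    (h : ∀ t, 0 < t → rootedDet t ∅ G.edgeFinset ≤ rootedDet t ∅ H.edgeFinset)
    (heq : H.incidenceEnergy = G.incidenceEnergy) {t : ℝ} (ht : 0 < t) :
    rootedDet t ∅ H.edgeFinset = rootedDet t ∅ G.edgeFinset := by
  simp only [← prod_one_add_mul_eigenvalues_signlessLapMatrix] at h ⊢
  exact prod_eq_of_sum_sqrt_eq (posSemidef_signlessLapMatrix G).eigenvalues_nonneg
    (posSemidef_signlessLapMatrix H).eigenvalues_nonneg h heq ht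

theorem incidenceEnergy_eq_of_iso (f : G ≃g H) : G.incidenceEnergy = H.incidenceEnergy := by
  have hdet (t : ℝ) : rootedDet t ∅ H.edgeFinset = rootedDet t ∅ G.edgeFinset := by
    simpa using rootedDet_edgeFinset_iso f t ∅
  exact (incidenceEnergy_le fun t _ => (hdet t).ge).antisymm
    (incidenceEnergy_le fun t _ => (hdet t).le)

end IncidenceEnergy

theorem not_isBipartite_of_odd_girth {V : Type*} {G : SimpleGraph V} (hodd : Odd G.girth) :
    ¬ G.IsBipartite := fun hG => by
  have hcyclic : ¬ G.IsAcyclic := fun hG => by simp [girth_eq_zero.2 hG] at hodd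
  obtain ⟨a, w, -, hlength⟩ := exists_girth_eq_length.2 hcyclic
  exact Nat.not_even_iff_odd.2 (hlength ▸ hodd) (two_colorable_iff_forall_loop_even.1 hG a w)

theorem corollary5p3_general {V : Type*} [Fintype V] [DecidableEq V] {G : SimpleGraph V}
    [DecidableRel G.Adj] {k : ℕ} (hV : Fintype.card V = k + 3) (hG : G.Connected)
    (hbip : ¬ G.IsBipartite) :
    (trianglePendant k).incidenceEnergy ≤ G.incidenceEnergy ∧
      (G.incidenceEnergy = (trianglePendant k).incidenceEnergy ↔
        Nonempty (G ≃g trianglePendant k)) := by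
  have hdet : ∀ t, 0 < t →
      rootedDet t ∅ (trianglePendant k).edgeFinset ≤ rootedDet t ∅ G.edgeFinset := fun t ht =>
    (rootedDet_trianglePendant ht k).trans_le (extremalDet_le_rootedDet_edgeFinset hG hbip hV ht)
  refine ⟨incidenceEnergy_le hdet, fun heq => ?_, fun ⟨f⟩ => incidenceEnergy_eq_of_iso f⟩
  have hdet_one := rootedDet_eq_of_incidenceEnergy_eq hdet heq one_pos
  rw [rootedDet_trianglePendant one_pos] at hdet_one
  exact nonempty_iso_trianglePendant_of_rootedDet_eq hG hbip hV one_pos hdet_one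

theorem corollary5p3 (n : ℕ) (hn : 3 ≤ n) :
    (Fintype.card (Fin 3 ⊕ Fin (n - 3)) = n ∧
      (trianglePendant (n - 3)).IsUnicyclic ∧ Odd (trianglePendant (n - 3)).girth) ∧
    ∀ (V : Type*) [Fintype V] [DecidableEq V] (G : SimpleGraph V) [DecidableRel G.Adj],
      Fintype.card V = n → G.IsUnicyclic → Odd G.girth →
        (trianglePendant (n - 3)).incidenceEnergy ≤ G.incidenceEnergy ∧
        (G.incidenceEnergy = (trianglePendant (n - 3)).incidenceEnergy ↔
          Nonempty (G ≃g trianglePendant (n - 3))) := by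
  refine ⟨⟨by simp [Nat.add_sub_cancel' hn], isUnicyclic_trianglePendant _, ?_⟩,
    fun V _ _ G _ hV hG hodd =>
      corollary5p3_general (by lia) hG.1 (not_isBipartite_of_odd_girth hodd)⟩
  rw [girth_trianglePendant]
  decide
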